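/- Let $A$ be a bounded linear operator on a complex Banach space $\mathcal X$, let $\sigma(A)\subset\mathbb C$ be its spectrum, and let $\varepsilon>0$. Put $K_\delta=\{z\in\mathbb C:\operatorname{dist}(z,\sigma(A))\le\delta\}$ for $\delta>0$ and $\Gamma_\varepsilon=K_\varepsilon\setminus\operatorname{int}K_{\varepsilon/2}$. Then there exist polynomials $p,q\in\mathbb C[z]$ without common roots such that $\deg q<\deg p$, all roots of $p$ are simple, $q$ has no zero in $\sigma(A)\cup\Gamma_\varepsilon$, and the rational function $r=p/q$ satisfies $$\|r(A)\|<1\qquad\text{and}\qquad |r(z)|>1\quad\text{for all } z\in\Gamma_\varepsilon ,$$ where $r(A)=p(A)\,q(A)^{-1}$. (If $\mathcal X=\{0\}$, then $\sigma(A)$, $K_\delta$ and $\Gamma_\varepsilon$ are empty.) -/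

import Mathlib

open Polynomial

/-- The belt of width `ε / 2` around `K`: the closed `ε`-neighbourhood of `K` without the interior
of the closed `ε / 2`-neighbourhood. Both neighbourhoods are empty when `K` is empty. -/
def belt (K : Set ℂ) (ε : ℝ) : Set ℂ :=
  Metric.cthickening ε K \ interior (Metric.cthickening (ε / 2) K)

/-- The value `r(A) = p(A) q(A)⁻¹` of the rational function `r = p / q` at the bounded operator `A`.
It is meaningful when `q` has no zero in the spectrum of `A`, since `q(A)` is invertible then
(see `isUnit_aeval_of_spectrum`). -/
noncomputable def ratOp {E : Type*} [NormedAddCommGroup E] [NormedSpace ℂ E]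
    (p q : ℂ[X]) (A : E →L[ℂ] E) : E →L[ℂ] E :=
  aeval A p * Ring.inverse (aeval A q)

theorem isUnit_aeval_of_spectrum {E : Type*} [NormedAddCommGroup E] [NormedSpace ℂ E]
    (q : ℂ[X]) (hq : q ≠ 0) (A : E →L[ℂ] E) (h : ∀ z ∈ spectrum ℂ A, q.eval z ≠ 0) :
    IsUnit (aeval A q) := by
  by_contra hA
  have hs := IsAlgClosed.splits q
  rw [hs.eq_prod_roots, map_mul, aeval_C] at hA
  have hu : IsUnit (algebraMap ℂ (E →L[ℂ] E) q.leadingCoeff) :=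
    (isUnit_iff_ne_zero.2 (leadingCoeff_ne_zero.2 hq)).map _
  have hA' : ¬ IsUnit (aeval A (q.roots.map fun a => X - C a).prod) := fun h' => hA (hu.mul h')
  obtain ⟨k, hk, hr⟩ := spectrum.exists_mem_of_not_isUnit_aeval_prod hA'
  exact h k hk hr

/-! The spectrum and the belt are disjoint compact sets. A smooth compactly supported `h`, locally
constant near both, is `0` near the spectrum and `1` near the belt. Cauchy–Pompeiu writes `3h` there
as an integral of kernels `1 / (w - z)` whose poles lie off both sets, hence as a uniform limit of
rational functions (`exists_rational_approx`). This gives `r₀` with `|r₀| ≤ 1/2` on the spectrum and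
`|r₀| ≥ 2` on the belt.

By spectral mapping `r₀(A)` has spectral radius at most `1/2`, so by Gelfand's formula some power
`r₀ⁿ` has `‖r₀(A)ⁿ‖ < 1`; the lower bound on the belt survives.

Both estimates are stable under small perturbations. Adding `δ zᵏ` makes the numerator's degree the
larger one, and adding a constant `c` outside a finite set makes the zeros simple
(`exists_perturbation`). -/

open MeasureTheory Set Topology Filter

/-! ### The Cauchy–Pompeiu formula. -/

/-- Twice the Wirtinger derivative `∂h/∂z̄`. -/
noncomputable def twiceDbar (h : ℂ → ℂ) (w : ℂ) : ℂ :=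
  fderiv ℝ h w 1 + Complex.I * fderiv ℝ h w Complex.I

/-- The map `v ↦ T v + i T (i v)` kills the complex-linear part of `T` and doubles the antilinear
part, so a factor in `v` comes out conjugated. -/
theorem clm_add_I_mul_rotate (T : ℂ →L[ℝ] ℂ) (a b : ℝ) :
    T (a + b * Complex.I) + Complex.I * T (Complex.I * (a + b * Complex.I)) =
      (a - b * Complex.I) * (T 1 + Complex.I * T Complex.I) := by
  have h1 : (a + b * Complex.I : ℂ) = a • (1 : ℂ) + b • Complex.I := by simp
  have h2 : Complex.I * (a + b * Complex.I : ℂ) = a • Complex.I - b • (1 : ℂ) := by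
    simp only [Complex.real_smul]; ring_nf; simp; ring
  rw [h2, h1]
  rw [map_add, map_sub, map_smul, map_smul, map_smul, map_smul]
  simp only [Complex.real_smul]
  ring_nf
  simp only [Complex.I_sq]
  ring

theorem fderiv_eq_zero_of_eventuallyEq_const {h : ℂ → ℂ} {w c : ℂ} (hw : ∀ᶠ x in 𝓝 w, h x = c) :
    fderiv ℝ h w = 0 := by
  have : h =ᶠ[𝓝 w] fun _ => c := hw
  rw [this.fderiv_eq, fderiv_const_apply]

theorem HasCompactSupport.exists_radius {h : ℂ → ℂ} (hs : HasCompactSupport h) :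
    ∃ R : ℝ, 0 < R ∧ ∀ w : ℂ, R < ‖w‖ → h w = 0 ∧ fderiv ℝ h w = 0 := by
  obtain ⟨R, hR, hsub⟩ := hs.isCompact.isBounded.subset_closedBall_lt 0 0
  refine ⟨R, hR, fun w hw => ?_⟩
  have hw' : w ∉ tsupport h := fun hw' => by
    have := hsub hw'
    rw [mem_closedBall_zero_iff] at this
    linarith
  exact ⟨image_eq_zero_of_notMem_tsupport hw',
    fderiv_eq_zero_of_eventuallyEq_const (notMem_tsupport_iff_eventuallyEq.1 hw')⟩

theorem norm_cos_add_sin_mul_I (θ : ℝ) : ‖(Real.cos θ + Real.sin θ * Complex.I : ℂ)‖ = 1 := by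
  have := Complex.norm_exp_ofReal_mul_I θ
  rwa [Complex.exp_mul_I, ← Complex.ofReal_cos, ← Complex.ofReal_sin] at this

theorem integrableOn_polarCoord_target {G : ℝ × ℝ → ℂ} (hG : Continuous G) {R : ℝ}
    (hR : ∀ p : ℝ × ℝ, R < p.1 → G p = 0) :
    IntegrableOn G (Ioi (0 : ℝ) ×ˢ Ioo (-Real.pi) Real.pi) (volume.prod volume) := by
  have h1 : IntegrableOn G (Icc 0 R ×ˢ Icc (-Real.pi) Real.pi) (volume.prod volume) :=
    hG.continuousOn.integrableOn_compact (isCompact_Icc.prod isCompact_Icc)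
  refine h1.of_forall_sdiff_eq_zero (measurableSet_Ioi.prod measurableSet_Ioo) ?_
  rintro ⟨r, θ⟩ ⟨⟨hr, hθ⟩, hn⟩
  refine hR _ (lt_of_not_ge fun hle => hn ⟨⟨le_of_lt hr, hle⟩, Ioo_subset_Icc_self hθ⟩)

theorem integral_radial_deriv {h : ℂ → ℂ} (hd : ContDiff ℝ 1 h) (hs : HasCompactSupport h)
    {e : ℂ} (he : ‖e‖ = 1) : ∫ r in Ioi (0 : ℝ), fderiv ℝ h (r * e) e = -h 0 := by
  have hder : ∀ r : ℝ, HasDerivAt (fun r : ℝ => h (r * e)) (fderiv ℝ h (r * e) e) r := fun r => by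
    have h2 : HasDerivAt (fun r : ℝ => (r : ℂ) * e) e r := by
      simpa using (Complex.ofRealCLM.hasDerivAt (x := r)).mul_const e
    exact ((hd.differentiable one_ne_zero _).hasFDerivAt).comp_hasDerivAt r h2
  have hc : ContDiff ℝ 1 (fun r : ℝ => h (r * e)) :=
    hd.comp (Complex.ofRealCLM.contDiff.mul contDiff_const)
  obtain ⟨R, hR, hz⟩ := hs.exists_radius
  have hcs : HasCompactSupport (fun r : ℝ => h (r * e)) := by
    refine HasCompactSupport.intro (isCompact_Icc (a := -R) (b := R)) fun r hr => ?_
    refine (hz _ ?_).1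
    rw [norm_mul, he, mul_one, Complex.norm_real, Real.norm_eq_abs]
    exact lt_of_not_ge fun hle => hr (abs_le.1 hle)
  have := hcs.integral_Ioi_deriv_eq hc 0
  simpa [(hder _).deriv] using this

theorem integral_angular_deriv {h : ℂ → ℂ} (hd : ContDiff ℝ 1 h) {r : ℝ} (hr : r ≠ 0) :
    ∫ θ in Ioo (-Real.pi) Real.pi, fderiv ℝ h (r * (Real.cos θ + Real.sin θ * Complex.I))
      (Complex.I * (Real.cos θ + Real.sin θ * Complex.I)) = 0 := by
  set e : ℝ → ℂ := fun θ => Real.cos θ + Real.sin θ * Complex.I with he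
  have hec : Continuous e := by fun_prop
  have hed : ∀ θ, HasDerivAt e (Complex.I * e θ) θ := fun θ => by
    have h1 := (Real.hasDerivAt_cos θ).ofReal_comp
    have h2 := (Real.hasDerivAt_sin θ).ofReal_comp.mul_const Complex.I
    refine (h1.add h2).congr_deriv ?_
    simp only [he]
    push_cast
    ring_nf
    simp
  have hder : ∀ θ : ℝ, HasDerivAt (fun θ : ℝ => h (r * e θ))
      (r • fderiv ℝ h (r * e θ) (Complex.I * e θ)) θ := fun θ => by
    have h2 := (hed θ).const_mul (r : ℂ)
    have h3 := ((hd.differentiable one_ne_zero (r * e θ)).hasFDerivAt).comp_hasDerivAt θ h2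
    refine h3.congr_deriv ?_
    rw [← map_smul, Complex.real_smul]
  have hcont : Continuous fun θ : ℝ => fderiv ℝ h (r * e θ) (Complex.I * e θ) :=
    ((hd.continuous_fderiv one_ne_zero).comp (by fun_prop)).clm_apply (by fun_prop)
  have key := intervalIntegral.integral_eq_sub_of_hasDerivAt (a := -Real.pi) (b := Real.pi)
    (fun θ _ => hder θ) ((hcont.const_smul r).intervalIntegrable _ _)
  rw [intervalIntegral.integral_smul, show e Real.pi = e (-Real.pi) by simp [he], sub_self,
    smul_eq_zero] at key
  have key' := key.resolve_left hr
  rwa [intervalIntegral.integral_of_le (by linarith [Real.pi_pos]),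
    integral_Ioc_eq_integral_Ioo] at key'

/-- In polar coordinates the Jacobian cancels the singularity, leaving a radial derivative plus `i`
times an angular one. The first integrates to `-h 0` along each ray, the second to `0` on each
circle. -/
theorem integral_twiceDbar_div {h : ℂ → ℂ} (hd : ContDiff ℝ 1 h) (hs : HasCompactSupport h) :
    ∫ w, twiceDbar h w / w = -(2 * Real.pi) * h 0 := by
  set e : ℝ → ℂ := fun θ => Real.cos θ + Real.sin θ * Complex.I with he
  have hec : Continuous e := by fun_prop
  have hne : ∀ θ, ‖e θ‖ = 1 := norm_cos_add_sin_mul_I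
  have hne0 : ∀ θ, e θ ≠ 0 := fun θ h0 => by simpa [h0] using hne θ
  obtain ⟨R, hR, hz⟩ := hs.exists_radius
  have hfc := hd.continuous_fderiv one_ne_zero
  have hvan : ∀ p : ℝ × ℝ, R < p.1 → fderiv ℝ h (p.1 * e p.2) = 0 := fun p hp => by
    refine (hz _ ?_).2
    rw [norm_mul, hne, mul_one, Complex.norm_real]
    exact hp.trans_le (le_abs_self _)
  set a : ℝ × ℝ → ℂ := fun p => fderiv ℝ h (p.1 * e p.2) (e p.2) with ha
  set b : ℝ × ℝ → ℂ := fun p => fderiv ℝ h (p.1 * e p.2) (Complex.I * e p.2) with hb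
  have hac : Continuous a := (hfc.comp (by fun_prop)).clm_apply (by fun_prop)
  have hbc : Continuous b := (hfc.comp (by fun_prop)).clm_apply (by fun_prop)
  have hai := integrableOn_polarCoord_target hac (R := R) fun p hp => by simp [ha, hvan p hp]
  have hbi := integrableOn_polarCoord_target hbc (R := R) fun p hp => by simp [hb, hvan p hp]
  have hA : ∫ p in Ioi (0 : ℝ) ×ˢ Ioo (-Real.pi) Real.pi, a p ∂(volume.prod volume) =
      -(2 * Real.pi) * h 0 := by
    rw [← Measure.prod_restrict, integral_prod_symm]
    · simp only [ha]
      simp_rw [integral_radial_deriv hd hs (hne _)]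
      rw [setIntegral_const, Real.volume_real_Ioo_of_le (by linarith [Real.pi_pos]),
        Complex.real_smul]
      push_cast
      ring
    · rw [Measure.prod_restrict]; exact hai
  have hB : ∫ p in Ioi (0 : ℝ) ×ˢ Ioo (-Real.pi) Real.pi, b p ∂(volume.prod volume) = 0 := by
    rw [setIntegral_prod _ hbi]
    refine setIntegral_eq_zero_of_forall_eq_zero fun r hr => ?_
    exact integral_angular_deriv hd (ne_of_gt hr)
  have hconj : ∀ θ, (Real.cos θ - Real.sin θ * Complex.I) * e θ = 1 := fun θ => by
    have h1 : (Real.cos θ : ℂ) ^ 2 + (Real.sin θ : ℂ) ^ 2 = 1 := by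
      exact_mod_cast Real.cos_sq_add_sin_sq θ
    simp only [he]
    linear_combination h1 - (Real.sin θ : ℂ) ^ 2 * Complex.I_sq
  rw [← Complex.integral_comp_polarCoord_symm, polarCoord_target]
  have hcongr : ∀ p ∈ Ioi (0 : ℝ) ×ˢ Ioo (-Real.pi) Real.pi,
      p.1 • (twiceDbar h (Complex.polarCoord.symm p) / Complex.polarCoord.symm p) =
        a p + Complex.I * b p := by
    rintro ⟨r, θ⟩ ⟨hr, -⟩
    have hr' : (r : ℂ) ≠ 0 := by exact_mod_cast (ne_of_gt hr : r ≠ 0)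
    have hrot := clm_add_I_mul_rotate (fderiv ℝ h (r * e θ)) (Real.cos θ) (Real.sin θ)
    rw [Complex.polarCoord_symm_apply]
    change r • (twiceDbar h (r * e θ) / (r * e θ)) = fderiv ℝ h (r * e θ) (e θ) +
      Complex.I * fderiv ℝ h (r * e θ) (Complex.I * e θ)
    refine Eq.trans ?_ hrot.symm
    rw [eq_inv_of_mul_eq_one_left (hconj θ), Complex.real_smul, twiceDbar]
    have := hne0 θ
    field_simp
  rw [setIntegral_congr_fun (measurableSet_Ioi.prod measurableSet_Ioo) hcongr]
  rw [Measure.volume_eq_prod, integral_add hai (hbi.const_mul _), hA, integral_const_mul, hB]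
  simp

/-- The Cauchy–Pompeiu formula for compactly supported functions. -/
theorem integral_twiceDbar_div_sub {h : ℂ → ℂ} (hd : ContDiff ℝ 1 h) (hs : HasCompactSupport h)
    (z : ℂ) : ∫ w, twiceDbar h w / (w - z) = -(2 * Real.pi) * h z := by
  have h1 := integral_twiceDbar_div (h := fun w => h (w + z))
    (hd.comp (contDiff_id.add contDiff_const)) (hs.comp_homeomorph (Homeomorph.addRight z))
  rw [zero_add] at h1
  rw [← h1, ← integral_add_right_eq_self _ z]
  congr 1
  ext w
  simp [twiceDbar, fderiv_comp_add_right]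

theorem continuous_twiceDbar {h : ℂ → ℂ} (hd : ContDiff ℝ 1 h) : Continuous (twiceDbar h) := by
  have hfc := hd.continuous_fderiv one_ne_zero
  exact (hfc.clm_apply continuous_const).add
    (continuous_const.mul (hfc.clm_apply continuous_const))

/-! ### Uniform approximation by rational functions. -/

/-- The quotient map by `V` is continuous and linear, so it commutes with the integral, and it kills
the integrand. -/
theorem Submodule.integral_mem_of_isClosed {X M : Type*} [MeasurableSpace X] {μ : Measure X}
    [NormedAddCommGroup M] [NormedSpace ℂ M] [CompleteSpace M] (V : Submodule ℂ M)
    (hV : IsClosed (V : Set M)) {f : X → M} (hf : Integrable f μ) (hfV : ∀ x, f x ∈ V) :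
    ∫ x, f x ∂μ ∈ V := by
  have : IsClosed (V : Set M) := hV
  have h := V.mkQL.integral_comp_comm hf
  have h0 : ∀ x, V.mkQL (f x) = 0 := fun x => (Submodule.Quotient.mk_eq_zero V).2 (hfV x)
  simp only [h0, integral_zero] at h
  exact (Submodule.Quotient.mk_eq_zero V).1 h.symm

/-- The functions on `S` given by rational functions without poles in `S`. -/
def rationalSubmodule (S : Set ℂ) : Submodule ℂ C(S, ℂ) where
  carrier := {f | ∃ p q : ℂ[X], ∀ z : S, q.eval (z : ℂ) ≠ 0 ∧ f z = p.eval (z : ℂ) / q.eval (z : ℂ)}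
  zero_mem' := ⟨0, 1, fun z => by simp⟩
  add_mem' := by
    rintro f g ⟨p, q, h⟩ ⟨p', q', h'⟩
    refine ⟨p * q' + q * p', q * q', fun z => ⟨?_, ?_⟩⟩
    · simpa using ⟨(h z).1, (h' z).1⟩
    · have h1 := (h z).1
      have h2 := (h' z).1
      rw [ContinuousMap.add_apply, (h z).2, (h' z).2, div_add_div _ _ h1 h2]
      simp
  smul_mem' := by
    rintro c f ⟨p, q, h⟩
    refine ⟨C c * p, q, fun z => ⟨(h z).1, ?_⟩⟩
    rw [ContinuousMap.smul_apply, (h z).2]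
    simp [mul_div_assoc]

/-- The inclusion of a set of complex numbers. -/
def coordMap (S : Set ℂ) : C(S, ℂ) := ⟨Subtype.val, continuous_subtype_val⟩

theorem isUnit_algebraMap_sub_coordMap {S : Set ℂ} {w : ℂ} (hw : w ∉ S) :
    IsUnit (algebraMap ℂ C(S, ℂ) w - coordMap S) := by
  rw [ContinuousMap.isUnit_iff_forall_ne_zero]
  intro z
  simp only [ContinuousMap.sub_apply, coordMap, ContinuousMap.coe_mk]
  rw [sub_ne_zero]
  rintro h
  exact hw (by rw [show w = (z : ℂ) from h]; exact z.2)

/-- Seeing the Cauchy kernel as a resolvent in `C(S, ℂ)` gives its continuity in `w`, uniformly in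
`z`, from general resolvent theory. -/
theorem resolvent_coordMap_apply {S : Set ℂ} {w : ℂ} (hw : w ∉ S) (z : S) :
    resolvent (coordMap S) w z = (w - z)⁻¹ := by
  have h := Ring.inverse_mul_cancel _ (isUnit_algebraMap_sub_coordMap hw)
  have h' := congrArg (fun f : C(S, ℂ) => f z) h
  exact eq_inv_of_mul_eq_one_left h'

theorem resolvent_coordMap_mem {S : Set ℂ} {w : ℂ} (hw : w ∉ S) :
    resolvent (coordMap S) w ∈ rationalSubmodule S := by
  refine ⟨1, C w - X, fun z => ⟨?_, ?_⟩⟩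
  · simp only [eval_sub, eval_C, eval_X]
    rw [sub_ne_zero]
    rintro h
    exact hw (by rw [h]; exact z.2)
  · rw [resolvent_coordMap_apply hw]; simp

/-- A function that is `C¹` with compact support and locally constant near `S` is, on `S`, a
uniform limit of rational functions. -/
theorem exists_rational_approx {S : Set ℂ} (hS : IsCompact S) {h : ℂ → ℂ} (hd : ContDiff ℝ 1 h)
    (hs : HasCompactSupport h) (hloc : ∀ z ∈ S, ∃ c, ∀ᶠ w in 𝓝 z, h w = c) {η : ℝ} (hη : 0 < η) :
    ∃ p q : ℂ[X], ∀ z ∈ S, q.eval z ≠ 0 ∧ ‖p.eval z / q.eval z - h z‖ < η := by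
  have : CompactSpace S := isCompact_iff_compactSpace.1 hS
  set V := (rationalSubmodule S).topologicalClosure
  set f : ℂ → C(S, ℂ) := fun w => twiceDbar h w • resolvent (coordMap S) w with hf
  have hzero : ∀ z ∈ S, ∀ᶠ w in 𝓝 z, twiceDbar h w = 0 := fun z hz => by
    obtain ⟨c, hc⟩ := hloc z hz
    filter_upwards [hc.eventually_nhds] with w hw
    simp [twiceDbar, fderiv_eq_zero_of_eventuallyEq_const hw]
  -- At points of `S` the density `twiceDbar h` vanishes on a neighbourhood, so the kernel's
  -- singularity plays no role.
  have hfcont : Continuous f := by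
    rw [continuous_iff_continuousAt]
    intro w
    by_cases hw : w ∈ S
    · have : f =ᶠ[𝓝 w] fun _ => 0 := by
        filter_upwards [hzero w hw] with x hx
        simp [hf, hx]
      exact continuousAt_const.congr this.symm
    · exact (continuous_twiceDbar hd).continuousAt.smul
        (spectrum.hasDerivAt_resolvent_const_left (isUnit_algebraMap_sub_coordMap hw)).continuousAt
  have hfsupp : HasCompactSupport f := by
    obtain ⟨R, hR, hz⟩ := hs.exists_radius
    refine HasCompactSupport.intro (isCompact_closedBall 0 R) fun w hw => ?_
    rw [mem_closedBall_zero_iff, not_le] at hw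
    simp [hf, twiceDbar, (hz w hw).2]
  have hfint : Integrable f := hfcont.integrable_of_hasCompactSupport hfsupp
  have hmem : ∫ w, f w ∈ V := by
    refine V.integral_mem_of_isClosed (Submodule.isClosed_topologicalClosure _) hfint fun w => ?_
    by_cases hw : w ∈ S
    · have : f w = 0 := by simp [hf, (hzero w hw).self_of_nhds]
      rw [this]; exact V.zero_mem
    · exact V.smul_mem _ ((rationalSubmodule S).le_topologicalClosure (resolvent_coordMap_mem hw))
  have hval : ∀ z : S, (∫ w, f w) z = -(2 * Real.pi) * h z := fun z => by
    have h1 := (ContinuousMap.evalCLM ℂ z).integral_comp_comm hfint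
    rw [ContinuousMap.evalCLM_apply] at h1
    rw [← h1, ← integral_twiceDbar_div_sub hd hs]
    congr 1
    ext w
    by_cases hw : w ∈ S
    · simp [hf, (hzero w hw).self_of_nhds]
    · simp [hf, resolvent_coordMap_apply hw, div_eq_mul_inv]
  have hpi : (-(2 * Real.pi) : ℂ) ≠ 0 := by
    simp [Real.pi_ne_zero]
  have hmem2 := V.smul_mem (-(2 * Real.pi) : ℂ)⁻¹ hmem
  obtain ⟨g, ⟨p, q, hg⟩, hdist⟩ := Metric.mem_closure_iff.1 hmem2 η hη
  refine ⟨p, q, fun z hz => ⟨(hg ⟨z, hz⟩).1, ?_⟩⟩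
  have h1 := (ContinuousMap.dist_apply_le_dist (⟨z, hz⟩ : S)).trans_lt hdist
  rw [dist_comm, dist_eq_norm, (hg ⟨z, hz⟩).2, ContinuousMap.smul_apply, hval, smul_eq_mul,
    inv_mul_cancel_left₀ hpi] at h1
  exact h1

/-! ### Separating two disjoint compact sets. -/

theorem exists_contDiff_indicator {K L : Set ℂ} (hK : IsCompact K) (hL : IsCompact L)
    (hKL : Disjoint K L) : ∃ h : ℂ → ℂ, ContDiff ℝ 1 h ∧ HasCompactSupport h ∧
      (∀ z ∈ K, ∀ᶠ w in 𝓝 z, h w = 0) ∧ ∀ z ∈ L, ∀ᶠ w in 𝓝 z, h w = 1 := by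
  obtain ⟨δ, hδ, hdisj⟩ := hKL.exists_cthickenings hK hL.isClosed
  obtain ⟨R, hR⟩ := (hL.cthickening (r := δ)).isBounded.subset_closedBall 0
  -- Including the outside of a large ball in the zero set forces compact support.
  have hc1 : IsClosed (Metric.cthickening δ K ∪ (Metric.ball (0 : ℂ) (R + 1))ᶜ) :=
    Metric.isClosed_cthickening.union Metric.isOpen_ball.isClosed_compl
  have hdj : Disjoint (Metric.cthickening δ K ∪ (Metric.ball (0 : ℂ) (R + 1))ᶜ)
      (Metric.cthickening δ L) := by
    refine hdisj.union_left (disjoint_left.2 fun z hz hz' => hz ?_)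
    have := hR hz'
    rw [mem_closedBall_zero_iff] at this
    rw [mem_ball_zero_iff]
    linarith
  obtain ⟨g, hg0, hg1, -⟩ := exists_contMDiffMap_zero_one_of_isClosed (n := 1)
    (modelWithCornersSelf ℝ ℂ) hc1 Metric.isClosed_cthickening hdj
  refine ⟨fun z => (g z : ℂ), Complex.ofRealCLM.contDiff.comp g.contMDiff.contDiff, ?_, ?_, ?_⟩
  · refine HasCompactSupport.intro (isCompact_closedBall 0 (R + 1)) fun z hz => ?_
    have : g z = 0 := hg0 (Or.inr fun hb => hz (Metric.ball_subset_closedBall hb))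
    simp [this]
  · intro z hz
    filter_upwards [mem_of_superset (Metric.isOpen_thickening.mem_nhds
      (Metric.self_subset_thickening hδ K hz)) (Metric.thickening_subset_cthickening δ K)] with w hw
    have : g w = 0 := hg0 (Or.inl hw)
    simp [this]
  · intro z hz
    filter_upwards [mem_of_superset (Metric.isOpen_thickening.mem_nhds
      (Metric.self_subset_thickening hδ L hz)) (Metric.thickening_subset_cthickening δ L)] with w hw
    have : g w = 1 := hg1 hw
    simp [this]

theorem exists_coprime_rational_separating {K L : Set ℂ} (hK : IsCompact K) (hL : IsCompact L)
    (hKL : Disjoint K L) : ∃ p q : ℂ[X], IsCoprime p q ∧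
      (∀ z ∈ K, q.eval z ≠ 0 ∧ ‖p.eval z / q.eval z‖ ≤ 1 / 2) ∧
      ∀ z ∈ L, q.eval z ≠ 0 ∧ 2 ≤ ‖p.eval z / q.eval z‖ := by
  obtain ⟨h, hd, hs, h0, h1⟩ := exists_contDiff_indicator hK hL hKL
  -- Height `3` and error `1/2` give modulus at most `1/2` on `K` and at least `5/2` on `L`.
  obtain ⟨p, q, hpq⟩ := exists_rational_approx (hK.union hL) (contDiff_const.mul hd)
    (hs.mul_left (f := fun _ => (3 : ℂ)))
    (fun z hz => hz.elim
      (fun hz => ⟨0, (h0 z hz).mono fun w hw => by simp [hw]⟩)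
      (fun hz => ⟨3, (h1 z hz).mono fun w hw => by simp [hw]⟩)) (η := 1 / 2) (by norm_num)
  by_cases hq : q = 0
  · have hKe : ∀ z, z ∉ K ∪ L := fun z hz => (hpq z hz).1 (by simp [hq])
    exact ⟨0, 1, isCoprime_one_right, fun z hz => absurd (Or.inl hz) (hKe z),
      fun z hz => absurd (Or.inr hz) (hKe z)⟩
  obtain ⟨p', q', hc, hp', hq'⟩ : ∃ p' q' : ℂ[X], IsCoprime p' q' ∧
      p = EuclideanDomain.gcd p q * p' ∧ q = EuclideanDomain.gcd p q * q' := by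
    obtain ⟨p', hp'⟩ := EuclideanDomain.gcd_dvd_left p q
    obtain ⟨q', hq'⟩ := EuclideanDomain.gcd_dvd_right p q
    refine ⟨p', q', ?_, hp', hq'⟩
    have hg : EuclideanDomain.gcd p q ≠ 0 := fun h => hq ((EuclideanDomain.gcd_eq_zero_iff.1 h).2)
    have hb := EuclideanDomain.gcd_eq_gcd_ab p q
    refine ⟨EuclideanDomain.gcdA p q, EuclideanDomain.gcdB p q, mul_left_cancel₀ hg ?_⟩
    calc _ = (EuclideanDomain.gcd p q * p') * EuclideanDomain.gcdA p q +
          (EuclideanDomain.gcd p q * q') * EuclideanDomain.gcdB p q := by ring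
      _ = _ := by rw [← hp', ← hq', ← hb, mul_one]
  generalize EuclideanDomain.gcd p q = g at hp' hq'
  have key : ∀ z ∈ K ∪ L, q'.eval z ≠ 0 ∧ ‖p'.eval z / q'.eval z - 3 * h z‖ < 1 / 2 := by
    intro z hz
    have := hpq z hz
    rw [hp', hq', eval_mul, eval_mul] at this
    obtain ⟨hne, hlt⟩ := this
    rw [mul_div_mul_left _ _ (left_ne_zero_of_mul hne)] at hlt
    exact ⟨right_ne_zero_of_mul hne, hlt⟩
  refine ⟨p', q', hc, fun z hz => ?_, fun z hz => ?_⟩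
  · obtain ⟨hne, hlt⟩ := key z (Or.inl hz)
    rw [(h0 z hz).self_of_nhds, mul_zero, sub_zero] at hlt
    exact ⟨hne, hlt.le⟩
  · obtain ⟨hne, hlt⟩ := key z (Or.inr hz)
    rw [(h1 z hz).self_of_nhds, mul_one] at hlt
    refine ⟨hne, ?_⟩
    have := norm_sub_norm_le (3 : ℂ) (p'.eval z / q'.eval z)
    rw [norm_sub_rev] at this
    have h3 : ‖(3 : ℂ)‖ = 3 := by simp
    linarith

/-! ### Simple zeros through the Wronskian. -/

theorem Polynomial.ne_zero_or_of_isCoprime_eval {p q : ℂ[X]} (hc : IsCoprime p q) (z : ℂ) :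
    p.eval z ≠ 0 ∨ q.eval z ≠ 0 := by
  obtain ⟨a, b, hab⟩ := hc
  by_contra! h
  have := congrArg (eval z) hab
  simp [h.1, h.2] at this

/-- For coprime `p` and `q`, the zeros of `p / q + c` are simple for all but finitely many `c`. -/
theorem Polynomial.finite_setOf_not_nodup_roots_add_C_mul {p q : ℂ[X]} (hc : IsCoprime p q)
    (hdeg : q.natDegree < p.natDegree) : {c : ℂ | ¬ (p + C c * q).roots.Nodup}.Finite := by
  have hW : wronskian p q ≠ 0 := fun h => by
    have h1 := derivative_eq_zero.1 (hc.wronskian_eq_zero_iff.1 h).1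
    omega
  -- A multiple zero `z` of `p + c q` is a zero of the Wronskian, and it determines `c = -p(z) /
  -- q(z)`.
  refine ((wronskian p q).roots.toFinset.finite_toSet.image
    fun z => -(p.eval z / q.eval z)).subset fun c hcc => ?_
  have hne : p + C c * q ≠ 0 := fun h0 => hcc (by simp [h0])
  rw [mem_ofPred_eq, Multiset.nodup_iff_count_le_one] at hcc
  push Not at hcc
  obtain ⟨z, hz⟩ := hcc
  rw [count_roots, one_lt_rootMultiplicity_iff_isRoot hne] at hz
  obtain ⟨h1, h2⟩ := hz
  simp only [IsRoot, derivative_add, derivative_mul, derivative_C, zero_mul, zero_add, eval_add,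
    eval_mul, eval_C] at h1 h2
  have hq : q.eval z ≠ 0 := fun hq => by
    rw [hq, mul_zero, add_zero] at h1
    exact (ne_zero_or_of_isCoprime_eval hc z).elim (fun h => h h1) (fun h => h hq)
  refine ⟨z, ?_, ?_⟩
  · rw [Finset.mem_coe, Multiset.mem_toFinset, mem_roots hW, IsRoot, wronskian, eval_sub,
      eval_mul, eval_mul]
    linear_combination (derivative q).eval z * h1 - q.eval z * h2
  · simp only
    field_simp
    linear_combination -h1

/-! ### Rational functions of an operator. -/

section ratOp

variable {E : Type*} [NormedAddCommGroup E] [NormedSpace ℂ E]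

theorem commute_aeval_aeval (p q : ℂ[X]) (A : E →L[ℂ] E) : Commute (aeval A p) (aeval A q) := by
  rw [Commute, SemiconjBy, ← map_mul, ← map_mul, mul_comm]

theorem ratOp_add_mul (p q s : ℂ[X]) (A : E →L[ℂ] E) (hq : IsUnit (aeval A q)) :
    ratOp (p + s * q) q A = ratOp p q A + aeval A s := by
  rw [ratOp, ratOp, map_add, map_mul, add_mul, mul_assoc, Ring.mul_inverse_cancel _ hq, mul_one]

theorem Commute.mul_ringInverse {M : Type*} [MonoidWithZero M] {a b : M} (h : Commute a b) :
    Commute a (Ring.inverse b) := by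
  by_cases hb : IsUnit b
  · obtain ⟨u, rfl⟩ := hb
    rw [Ring.inverse_unit]
    exact h.units_inv_right
  · rw [Ring.inverse_non_unit _ hb, Commute, SemiconjBy, mul_zero, zero_mul]

theorem ratOp_pow (p q : ℂ[X]) (A : E →L[ℂ] E) (n : ℕ) :
    ratOp (p ^ n) (q ^ n) A = ratOp p q A ^ n := by
  rw [ratOp, ratOp, map_pow, map_pow, ← Ring.inverse_pow,
    (commute_aeval_aeval p q A |>.mul_ringInverse).mul_pow]

/-- Since `c - r(A) = -(p - c q)(A) q(A)⁻¹`, this operator is invertible unless `p - c q` vanishes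
somewhere on the spectrum. Nonemptiness of the spectrum covers `p = c q`. -/
theorem spectrum_ratOp_subset [Nontrivial E] [CompleteSpace E] (p q : ℂ[X]) (A : E →L[ℂ] E)
    (hq : ∀ z ∈ spectrum ℂ A, q.eval z ≠ 0) :
    spectrum ℂ (ratOp p q A) ⊆ (fun z => p.eval z / q.eval z) '' spectrum ℂ A := by
  intro c hc
  have hq0 : q ≠ 0 := fun h => by
    obtain ⟨z, hz⟩ := spectrum.nonempty A
    exact hq z hz (by simp [h])
  have hu := isUnit_aeval_of_spectrum q hq0 A hq
  have hs : ∃ z ∈ spectrum ℂ A, (p + C (-c) * q).eval z = 0 := by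
    by_cases h0 : p + C (-c) * q = 0
    · obtain ⟨z, hz⟩ := spectrum.nonempty A
      exact ⟨z, hz, by rw [h0, eval_zero]⟩
    · by_contra! h
      have h1 := isUnit_aeval_of_spectrum _ h0 A h
      refine hc ?_
      change IsUnit (algebraMap ℂ _ c - ratOp p q A)
      have h2 : algebraMap ℂ _ c - ratOp p q A = -ratOp (p + C (-c) * q) q A := by
        rw [ratOp_add_mul _ _ _ _ hu, aeval_C, map_neg]
        abel
      rw [h2, ratOp]
      exact (h1.mul hu.ringInverse).neg
  obtain ⟨z, hz, hz0⟩ := hs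
  refine ⟨z, hz, ?_⟩
  simp only
  rw [div_eq_iff (hq z hz)]
  simp only [eval_add, eval_mul, eval_C] at hz0
  linear_combination hz0

theorem exists_norm_pow_lt_of_spectrum [CompleteSpace E] (B : E →L[ℂ] E)
    (hB : ∀ z ∈ spectrum ℂ B, ‖z‖ ≤ 1 / 2) : ∃ n : ℕ, 0 < n ∧ ‖B ^ n‖ < 1 := by
  have hr : spectralRadius ℂ B < 1 := by
    refine lt_of_le_of_lt (b := ((1 / 2 : NNReal) : ENNReal)) ?_ ?_
    · refine iSup₂_le fun z hz => ENNReal.coe_le_coe.2 ?_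
      have := hB z hz
      rw [← NNReal.coe_le_coe]
      simpa using this
    · rw [← ENNReal.coe_one, ENNReal.coe_lt_coe]
      exact NNReal.half_lt_self one_ne_zero
  have h1 := (spectrum.pow_nnnorm_pow_one_div_tendsto_nhds_spectralRadius B).eventually_lt_const hr
  obtain ⟨n, hn, hpos⟩ := (h1.and (eventually_gt_atTop 0)).exists
  refine ⟨n, hpos, ?_⟩
  by_contra! hge
  refine absurd hn (not_lt.2 ?_)
  refine ENNReal.one_le_rpow ?_ (by positivity)
  rw [← ENNReal.coe_one, ENNReal.coe_le_coe, ← NNReal.coe_le_coe]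
  simpa using hge

end ratOp

/-! ### The belt, the perturbation and the conclusion. -/

theorem belt_disjoint (K : Set ℂ) {ε : ℝ} (hε : 0 < ε) : Disjoint K (belt K ε) := by
  refine disjoint_left.2 fun z hz hb => hb.2 ?_
  exact interior_maximal (Metric.thickening_subset_cthickening (ε / 2) K)
    Metric.isOpen_thickening (Metric.self_subset_thickening (by linarith) K hz)

theorem isCompact_belt {K : Set ℂ} (hK : IsCompact K) (ε : ℝ) : IsCompact (belt K ε) :=
  hK.cthickening.diff isOpen_interior

/-- Adding a small multiple of a monomial gives a rational function a pole at infinity, and then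
adding a small constant makes all its zeros simple. -/
theorem exists_perturbation {p q : ℂ[X]} (hc : IsCoprime p q) (hq : q ≠ 0) {η : ℝ} (hη : 0 < η)
    (N : ℂ[X] → ℝ) (hN : ∀ s t : ℂ[X], N (s + t) ≤ N s + N t)
    (hN' : ∀ (c : ℂ) (s : ℂ[X]), N (C c * s) = ‖c‖ * N s) :
    ∃ s : ℂ[X], N s < η ∧ q.natDegree < (p + s * q).natDegree ∧ (p + s * q).roots.Nodup := by
  have hsmall : ∀ t : ℂ[X], ∀ᶠ c : ℂ in 𝓝[≠] 0, N (C c * t) < η / 2 := fun t => by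
    have : Tendsto (fun c : ℂ => ‖c‖ * N t) (𝓝[≠] 0) (𝓝 0) := by
      have : Tendsto (fun c : ℂ => ‖c‖ * N t) (𝓝 0) (𝓝 (‖(0 : ℂ)‖ * N t)) :=
        (continuous_norm.mul continuous_const).tendsto 0
      rw [norm_zero, zero_mul] at this
      exact this.mono_left nhdsWithin_le_nhds
    simp only [hN']
    exact this.eventually_lt_const (by positivity)
  -- With this `k`, the term `δ Xᵏ q` exceeds both `p` and `q` in degree.
  set k := p.natDegree + 1
  obtain ⟨δ, hδ, hδ0⟩ := ((hsmall (X ^ k)).and self_mem_nhdsWithin).exists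
  have hδ0 : δ ≠ 0 := hδ0
  have hdeg : (p + C δ * X ^ k * q).natDegree = k + q.natDegree := by
    have h1 : (C δ * X ^ k * q).natDegree = k + q.natDegree := by
      rw [natDegree_mul (by simp [hδ0]) hq, natDegree_C_mul_X_pow _ _ hδ0]
    rw [natDegree_add_eq_right_of_natDegree_lt (by omega), h1]
  have hc' : IsCoprime (p + C δ * X ^ k * q) q := hc.add_mul_right_left _
  have hfin := Polynomial.finite_setOf_not_nodup_roots_add_C_mul hc' (by omega)
  -- A punctured neighbourhood of `0` contains arbitrarily small `c` outside the finite exceptional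
  -- set.
  obtain ⟨c, hcN, hcn⟩ := ((hsmall 1).and
    (nhdsNE_le_cofinite 0 hfin.compl_mem_cofinite)).exists
  have heq : p + (C δ * X ^ k + C c * 1) * q = p + C δ * X ^ k * q + C c * q := by ring
  refine ⟨C δ * X ^ k + C c * 1, ?_, ?_, ?_⟩
  · linarith [hN (C δ * X ^ k) (C c * 1)]
  · rw [heq, natDegree_add_eq_left_of_natDegree_lt ((natDegree_C_mul_le _ _).trans_lt (by omega))]
    omega
  · rw [heq]
    exact not_not.1 hcn

theorem corollary2p2 {E : Type*} [NormedAddCommGroup E] [NormedSpace ℂ E] [CompleteSpace E]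
    (A : E →L[ℂ] E) (ε : ℝ) (hε : 0 < ε) :
    ∃ p q : ℂ[X],
      IsCoprime p q ∧
      q.natDegree < p.natDegree ∧
      p.roots.Nodup ∧
      (∀ z ∈ spectrum ℂ A, q.eval z ≠ 0) ∧
      ‖ratOp p q A‖ < 1 ∧
      ∀ z ∈ belt (spectrum ℂ A) ε, q.eval z ≠ 0 ∧ 1 < ‖p.eval z / q.eval z‖ := by
  rcases subsingleton_or_nontrivial E with hE | hE
  · refine ⟨X, 1, isCoprime_one_right, by simp, by simp, by simp, ?_, ?_⟩
    · rw [Subsingleton.elim (ratOp X 1 A) 0]; simp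
    · simp [belt]
  have hK : IsCompact (spectrum ℂ A) := spectrum.isCompact A
  have hL := isCompact_belt hK ε
  obtain ⟨p₀, q₀, hc₀, hp₀, hq₀⟩ :=
    exists_coprime_rational_separating hK hL (belt_disjoint (spectrum ℂ A) hε)
  obtain ⟨n, hn, hlt⟩ := exists_norm_pow_lt_of_spectrum (ratOp p₀ q₀ A) fun z hz => by
    obtain ⟨w, hw, rfl⟩ := spectrum_ratOp_subset p₀ q₀ A (fun w hw => (hp₀ w hw).1) hz
    exact (hp₀ w hw).2
  rw [← ratOp_pow] at hlt
  set p := p₀ ^ n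
  set q := q₀ ^ n with hqdef
  have hc : IsCoprime p q := hc₀.pow
  have hqK : ∀ z ∈ spectrum ℂ A, q.eval z ≠ 0 := fun z hz => by
    rw [hqdef, eval_pow]; exact pow_ne_zero _ (hp₀ z hz).1
  have hL2 : ∀ z ∈ belt (spectrum ℂ A) ε, q.eval z ≠ 0 ∧ 2 ≤ ‖p.eval z / q.eval z‖ := fun z hz => by
    simp only [p, q, eval_pow]
    refine ⟨pow_ne_zero _ (hq₀ z hz).1, ?_⟩
    rw [← div_pow, norm_pow]
    have h2 := (hq₀ z hz).2
    exact h2.trans (le_self_pow₀ (by linarith) hn.ne')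
  have hq0 : q ≠ 0 := fun h => by
    obtain ⟨z, hz⟩ := spectrum.nonempty A
    exact hqK z hz (by simp [h])
  have hu := isUnit_aeval_of_spectrum q hq0 A hqK
  have : CompactSpace (belt (spectrum ℂ A) ε) := isCompact_iff_compactSpace.1 hL
  -- One seminorm controls both the change of `r(A)` and the change of `r` on the belt.
  set N : ℂ[X] → ℝ := fun s => ‖aeval A s‖ + ‖s.toContinuousMapOn (belt (spectrum ℂ A) ε)‖ with hN
  have hadd : ∀ s t : ℂ[X], N (s + t) ≤ N s + N t := fun s t => by
    have h1 : (s + t).toContinuousMapOn (belt (spectrum ℂ A) ε) =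
        s.toContinuousMapOn _ + t.toContinuousMapOn _ := by ext; simp
    simp only [hN]
    rw [h1, map_add]
    linarith [norm_add_le (aeval A s) (aeval A t), norm_add_le
      (s.toContinuousMapOn (belt (spectrum ℂ A) ε)) (t.toContinuousMapOn _)]
  have hmul : ∀ (c : ℂ) (s : ℂ[X]), N (C c * s) = ‖c‖ * N s := fun c s => by
    have h1 : (C c * s).toContinuousMapOn (belt (spectrum ℂ A) ε) =
        c • s.toContinuousMapOn _ := by ext; simp
    simp only [hN]
    rw [h1, C_mul', map_smul, norm_smul, norm_smul, mul_add]
  -- The bound is the smaller of the two margins: `1 - ‖r(A)‖` for the operator, and `2 - 1` on the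
  -- belt.
  obtain ⟨s, hs, hdeg, hroots⟩ := exists_perturbation hc hq0
    (lt_min (sub_pos.2 hlt) one_pos) N hadd hmul
  obtain ⟨hs1, hs2⟩ := lt_min_iff.1 hs
  refine ⟨p + s * q, q, hc.add_mul_right_left _, hdeg, hroots, hqK, ?_, fun z hz => ?_⟩
  · rw [ratOp_add_mul _ _ _ _ hu]
    have h1 := norm_add_le (ratOp p q A) (aeval A s)
    have h2 : ‖aeval A s‖ ≤ N s := le_add_of_nonneg_right (norm_nonneg _)
    linarith
  · obtain ⟨hne, h2⟩ := hL2 z hz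
    refine ⟨hne, ?_⟩
    rw [eval_add, eval_mul, add_div, mul_div_cancel_right₀ _ hne]
    have h3 : ‖s.eval z‖ ≤ N s :=
      ((s.toContinuousMapOn (belt (spectrum ℂ A) ε)).norm_coe_le_norm ⟨z, hz⟩).trans
        (le_add_of_nonneg_left (norm_nonneg _))
    have h4 := norm_sub_norm_le (p.eval z / q.eval z) (-s.eval z)
    rw [norm_neg, sub_neg_eq_add] at h4
    linarith
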